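/- **Separation Lemma.** Let $\Sigma$ be a finite alphabet. *Forests* over $\Sigma$ are finite forests with nodes labelled in $\Sigma$, considered without regard to order and multiplicity of siblings; let $H_\Sigma$ be the set of all of them (including the empty forest). For a forest $f$, let $\pi(f)\subseteq\Sigma^*$ be the set of label words of its (not necessarily maximal) paths starting at a root, including the empty word. A *forest algebra* $(H,V)$ consists of a monoid $(H,+,0)$, a monoid $V$ acting faithfully on $H$, and a map $h\mapsto I_h\in V$ with $I_h g=h+g$; all forest algebras are assumed commutative and idempotent in $H$ ($g+h=h+g$, $h+h=h$). Morphisms are pairs of monoid morphisms $H\to H'$, $V\to V'$ that respect the action and $I$. The free forest algebra $\Sigma^\Delta=(H_\Sigma,V_\Sigma)$ consists of forests (under union) and contexts (forests in which exactly one leaf is a variable, under substitution). An algebra $(H,V)$ *recognizes* $L\subseteq H_\Sigma$ if $L=\varphi^{-1}(\varphi(L))$ for some morphism $\varphi:\Sigma^\Delta\to(H,V)$; $L$ is *regular* if a finite forest algebra recognizes it. An algebra is *distributive* if $v(h_1+h_2)=vh_1+vh_2$ for all $v\in V$ and $h_1,h_2\in H$. The *wreath product* is $(H_1,V_1)\wr(H_2,V_2)=(H_1\times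 H_2,\,V_1^{H_2}\times V_2)$ with the direct product structure on $H_1\times H_2$, the action $(f,v)(h_1,h_2)=(f(h_2)h_1,vh_2)$ and the product $(f,v)(f',v')=(f'',vv')$, $f''(h)=f(v'h)\,f'(h)$; it is associative up to isomorphism. Let $L_1,L_2\subseteq H_\Sigma$ be regular forest languages such that $$\{\pi(f):f\in L_1\}\cap\{\pi(f):f\in L_2\}=\emptyset .$$ Then there are finite distributive forest algebras $\mathcal F_1,\mathcal F_2,\mathcal F_3$ and a language $X\subseteq H_\Sigma$ recognized by $\mathcal F_1\wr\mathcal F_2\wr\mathcal F_3$ such that $$L_1\subseteq X\subseteq H_\Sigma\setminus L_2 .$$ -/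

import Mathlib

universe u v

/-- Forest algebras `(H, V)`, with the standing convention that they are horizontally commutative
and idempotent: `H` is a commutative idempotent monoid of forest types, `V` is a monoid of context
types acting faithfully on `H`, and `ins h` is the context type that adds `h`. -/
structure ForestAlg where
  /-- forest types -/
  H : Type u
  /-- context types -/
  V : Type u
  [addCommMonoidH : AddCommMonoid H]
  [monoidV : Monoid V]
  [mulActionVH : MulAction V H]
  [faithfulVH : FaithfulSMul V H]
  add_self : ∀ h : H, h + h = h
  /-- the insertion map `h ↦ I_h` -/
  ins : H → V
  ins_smul : ∀ h g : H, ins h • g = h + g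

attribute [instance] ForestAlg.addCommMonoidH ForestAlg.monoidV ForestAlg.mulActionVH
  ForestAlg.faithfulVH

namespace ForestAlg

/-- The usual axiom that each forest type is obtained from `0` by a context type holds
automatically. -/
theorem exists_smul_zero (F : ForestAlg.{u}) (h : F.H) : ∃ c : F.V, h = c • (0 : F.H) :=
  ⟨F.ins h, by rw [F.ins_smul, add_zero]⟩

/-- Morphisms of forest algebras. -/
structure Hom (F : ForestAlg.{u}) (G : ForestAlg.{v}) where
  /-- the map on forest types -/
  mapH : F.H →+ G.H
  /-- the map on context types -/
  mapV : F.V →* G.V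
  map_smul : ∀ (c : F.V) (h : F.H), mapH (c • h) = mapV c • mapH h
  map_ins : ∀ h : F.H, mapV (F.ins h) = G.ins (mapH h)

/-- A forest algebra is finite if both of its components are. -/
def IsFinite (F : ForestAlg.{u}) : Prop := Finite F.H ∧ Finite F.V

/-- The distributive law `c (h₁ + h₂) = c h₁ + c h₂`. -/
def IsDistributive (F : ForestAlg.{u}) : Prop :=
  ∀ (c : F.V) (h₁ h₂ : F.H), c • (h₁ + h₂) = c • h₁ + c • h₂

/-- Context types of the wreath product of `F` and `G`: pairs `(f, c)` in `F.V ^ G.H × G.V`. -/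
@[ext] structure WreathV (F : ForestAlg.{u}) (G : ForestAlg.{u}) where
  /-- the component in `F.V ^ G.H` -/
  fn : G.H → F.V
  /-- the component in `G.V` -/
  ctx : G.V

namespace WreathV

variable {F G : ForestAlg.{u}}

/-- `(f, c) (f', c') = (f'', c c')` with `f'' h = f (c' h) * f' h`. -/
instance : Monoid (WreathV F G) where
  mul p q := ⟨fun h => p.fn (q.ctx • h) * q.fn h, p.ctx * q.ctx⟩
  one := ⟨fun _ => 1, 1⟩
  mul_assoc p q r := WreathV.ext
    (funext fun h => by
      change p.fn (q.ctx • r.ctx • h) * q.fn (r.ctx • h) * r.fn h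
        = p.fn ((q.ctx * r.ctx) • h) * (q.fn (r.ctx • h) * r.fn h)
      rw [mul_smul, mul_assoc])
    (mul_assoc p.ctx q.ctx r.ctx)
  one_mul p := WreathV.ext (funext fun h => one_mul (p.fn h)) (one_mul p.ctx)
  mul_one p := WreathV.ext
    (funext fun h => by
      change p.fn ((1 : G.V) • h) * 1 = p.fn h
      rw [one_smul, mul_one])
    (mul_one p.ctx)

/-- `(f, c) (h₁, h₂) = (f h₂ h₁, c h₂)`. -/
instance : MulAction (WreathV F G) (F.H × G.H) where
  smul p h := (p.fn h.2 • h.1, p.ctx • h.2)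
  one_smul h := Prod.ext (one_smul F.V h.1) (one_smul G.V h.2)
  mul_smul p q h :=
    Prod.ext (mul_smul (p.fn (q.ctx • h.2)) (q.fn h.2) h.1) (mul_smul p.ctx q.ctx h.2)

instance : FaithfulSMul (WreathV F G) (F.H × G.H) where
  eq_of_smul_eq_smul {_ _} hpq := WreathV.ext
    (funext fun h₂ => eq_of_smul_eq_smul (α := F.H) fun h₁ =>
      congrArg Prod.fst (hpq (h₁, h₂)))
    (eq_of_smul_eq_smul (α := G.H) fun h₂ => congrArg Prod.snd (hpq (0, h₂)))

end WreathV

/-- The wreath product of `F` (left factor) and `G` (right factor); its forest types form the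
direct product of monoids. -/
def wreath (F G : ForestAlg.{u}) : ForestAlg.{u} where
  H := F.H × G.H
  V := WreathV F G
  add_self h := Prod.ext (F.add_self h.1) (G.add_self h.2)
  ins h := ⟨fun _ => F.ins h.1, G.ins h.2⟩
  ins_smul h g := Prod.ext (F.ins_smul h.1 g.1) (G.ins_smul h.2 g.2)

end ForestAlg

/-- Finite ordered forests with node labels in `A`: `nil` is the empty forest, and `cons a c r`
is the forest whose first tree has root label `a` and the forest `c` below its root, and whose
remaining trees form the forest `r`. -/
inductive PreForest (A : Type u) : Type u
  | nil : PreForest A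
  | cons (a : A) (c r : PreForest A) : PreForest A

namespace PreForest

variable {A : Type u}

/-- Equality of ordered forests up to order and multiplicity of siblings (at all nodes). -/
inductive Rel : PreForest A → PreForest A → Prop
  | refl (f : PreForest A) : Rel f f
  | symm {f g : PreForest A} : Rel f g → Rel g f
  | trans {f g h : PreForest A} : Rel f g → Rel g h → Rel f h
  | cons (a : A) {c c₁ r r₁ : PreForest A} : Rel c c₁ → Rel r r₁ → Rel (cons a c r) (cons a c₁ r₁)
  | swap (a b : A) (c d r : PreForest A) : Rel (cons a c (cons b d r)) (cons b d (cons a c r))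
  | dup (a : A) (c r : PreForest A) : Rel (cons a c (cons a c r)) (cons a c r)

/-- The setoid whose classes are unordered forests without multiplicities. -/
def setoid (A : Type u) : Setoid (PreForest A) := ⟨Rel, Rel.refl, Rel.symm, Rel.trans⟩

/-- Juxtaposition of ordered forests. -/
def append : PreForest A → PreForest A → PreForest A
  | nil, g => g
  | cons a c r, g => cons a c (append r g)

theorem append_nil (f : PreForest A) : append f nil = f := by
  induction f with
  | nil => rfl
  | cons a c r _ ih => simp only [append, ih]

theorem append_assoc (f g h : PreForest A) :
    append (append f g) h = append f (append g h) := by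
  induction f with
  | nil => rfl
  | cons a c r _ ih => simp only [append, ih]

theorem Rel.append_left {f f₁ : PreForest A} (h : Rel f f₁) (g : PreForest A) :
    Rel (append f g) (append f₁ g) := by
  induction h with
  | refl f => exact Rel.refl _
  | symm _ ih => exact ih.symm
  | trans _ _ ih₁ ih₂ => exact ih₁.trans ih₂
  | cons a hc _ _ ih => exact Rel.cons a hc ih
  | swap a b c d r => exact Rel.swap a b c d _
  | dup a c r => exact Rel.dup a c _

theorem Rel.append_right (f : PreForest A) {g g₁ : PreForest A} (h : Rel g g₁) :
    Rel (append f g) (append f g₁) := by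
  induction f with
  | nil => exact h
  | cons a c r _ ih => exact Rel.cons a (Rel.refl c) ih

theorem rel_append_cons (f : PreForest A) (a : A) (c g : PreForest A) :
    Rel (append f (cons a c g)) (cons a c (append f g)) := by
  induction f with
  | nil => exact Rel.refl _
  | cons b d r _ ih => exact (Rel.cons b (Rel.refl d) ih).trans (Rel.swap b a d c _)

theorem rel_append_comm (f g : PreForest A) : Rel (append f g) (append g f) := by
  induction f with
  | nil => rw [append_nil]; exact Rel.refl _
  | cons a c r _ ih =>
    exact (Rel.cons a (Rel.refl c) ih).trans (rel_append_cons g a c r).symm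

theorem rel_append_self (f : PreForest A) : Rel (append f f) f := by
  induction f with
  | nil => exact Rel.refl _
  | cons a c r _ ih =>
    exact ((Rel.cons a (Rel.refl c) (rel_append_cons r a c r)).trans (Rel.dup a c _)).trans
      (Rel.cons a (Rel.refl c) ih)

/-- The (not necessarily maximal) paths of a forest that start at a root, as words over `A`. The
empty path is always included. -/
def paths : PreForest A → Set (List A)
  | nil => {[]}
  | cons a c r => (List.cons a '' paths c) ∪ paths r

theorem Rel.paths_eq {f g : PreForest A} (h : Rel f g) : paths f = paths g := by
  induction h with
  | refl f => rfl
  | symm _ ih => exact ih.symm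
  | trans _ _ ih₁ ih₂ => exact ih₁.trans ih₂
  | cons a _ _ ih₁ ih₂ => simp only [paths, ih₁, ih₂]
  | swap a b c d r => simp only [paths]; exact Set.union_left_comm _ _ _
  | dup a c r => simp only [paths, ← Set.union_assoc, Set.union_self]

/-- The height of a forest: the maximal number of nodes on a path. -/
def height : PreForest A → ℕ
  | nil => 0
  | cons _ c r => max (height c + 1) (height r)

theorem Rel.height_eq {f g : PreForest A} (h : Rel f g) : height f = height g := by
  induction h with
  | refl f => rfl
  | symm _ ih => exact ih.symm
  | trans _ _ ih₁ ih₂ => exact ih₁.trans ih₂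
  | cons a _ _ ih₁ ih₂ => simp only [height, ih₁, ih₂]
  | swap a b c d r => simp only [height]; exact max_left_comm _ _ _
  | dup a c r => simp only [height, ← max_assoc, max_self]

theorem height_append (f g : PreForest A) : height (append f g) = max (height f) (height g) := by
  induction f with
  | nil => simp [append, height]
  | cons a c r _ ih => simp only [append, height, ih, max_assoc]

end PreForest

/-- The set `H_Σ` of finite forests over the alphabet `A`, without regard to order and
multiplicity of siblings. -/
def Forest (A : Type u) : Type u := Quotient (PreForest.setoid A)

namespace Forest

variable {A : Type u}

instance : Zero (Forest A) := ⟨Quotient.mk _ PreForest.nil⟩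

instance : Add (Forest A) :=
  ⟨Quotient.map₂ PreForest.append fun _ _ h₁ _ _ h₂ =>
    (PreForest.Rel.append_left h₁ _).trans (PreForest.Rel.append_right _ h₂)⟩

/-- Addition is union of forests, and `0` is the empty forest. -/
instance : AddCommMonoid (Forest A) where
  add_assoc := by
    rintro ⟨f⟩ ⟨g⟩ ⟨h⟩
    exact congrArg (Quotient.mk _) (PreForest.append_assoc f g h)
  zero_add := by
    rintro ⟨f⟩
    rfl
  add_zero := by
    rintro ⟨f⟩
    exact congrArg (Quotient.mk _) (PreForest.append_nil f)
  add_comm := by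
    rintro ⟨f⟩ ⟨g⟩
    exact Quotient.sound (PreForest.rel_append_comm f g)
  nsmul := nsmulRec

/-- The forest `a[f]` that consists of one tree, with root label `a` and the forest `f` below the
root. -/
def node (a : A) (f : Forest A) : Forest A :=
  Quotient.map (fun c => PreForest.cons a c PreForest.nil)
    (fun _ _ h => PreForest.Rel.cons a h (PreForest.Rel.refl _)) f

theorem add_self (f : Forest A) : f + f = f := by
  obtain ⟨f⟩ := f
  exact Quotient.sound (PreForest.rel_append_self f)

/-- The pathset `π(f)` of a forest. -/
def pathset (f : Forest A) : Set (List A) :=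
  Quotient.lift PreForest.paths (fun _ _ h => PreForest.Rel.paths_eq h) f

/-- Induction on forests: each is a finite sum of trees. -/
theorem induction {P : Forest A → Prop} (zero : P 0)
    (node_add : ∀ (a : A) (c r : Forest A), P c → P r → P (node a c + r)) (f : Forest A) : P f := by
  obtain ⟨f⟩ := f
  induction f with
  | nil => exact zero
  | cons a c r ih₁ ih₂ => exact node_add a _ _ ih₁ ih₂

theorem pathset_zero : pathset (0 : Forest A) = {[]} := rfl

theorem pathset_node_add (a : A) (c r : Forest A) :
    pathset (node a c + r) = (List.cons a '' pathset c) ∪ pathset r := by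
  obtain ⟨c⟩ := c
  obtain ⟨r⟩ := r
  rfl

/-- The height of a forest. -/
def height (f : Forest A) : ℕ :=
  Quotient.lift PreForest.height (fun _ _ h => PreForest.Rel.height_eq h) f

theorem height_add (f g : Forest A) : height (f + g) = max (height f) (height g) := by
  obtain ⟨f⟩ := f
  obtain ⟨g⟩ := g
  exact PreForest.height_append f g

theorem height_node (a : A) (f : Forest A) : height (node a f) = height f + 1 := by
  obtain ⟨f⟩ := f
  exact max_eq_left (Nat.zero_le _)

theorem height_zero : height (0 : Forest A) = 0 := rfl

end Forest

/-- The trees of an ordered forest, where the pair `(a, c)` stands for the tree `a[c]`. -/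
def PreForest.trees {A : Type u} : PreForest A → Set (A × Forest A)
  | nil => ∅
  | cons a c r => insert (a, Quotient.mk _ c) (trees r)

theorem PreForest.Rel.trees_eq {A : Type u} {f g : PreForest A} (h : Rel f g) :
    f.trees = g.trees := by
  induction h with
  | refl f => rfl
  | symm _ ih => exact ih.symm
  | trans _ _ ih₁ ih₂ => exact ih₁.trans ih₂
  | @cons a c c₁ _ _ hc _ _ ih₂ =>
    have e : (Quotient.mk _ c : Forest A) = Quotient.mk _ c₁ := Quotient.sound hc
    simp only [trees, ih₂, e]
  | swap a b c d r => simp only [trees]; exact Set.insert_comm _ _ _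
  | dup a c r => exact Set.insert_eq_of_mem (Or.inl rfl)

namespace Forest

variable {A : Type u}

/-- The set of trees of a forest, where the pair `(a, c)` stands for the tree `a[c]`. -/
def trees (f : Forest A) : Set (A × Forest A) :=
  Quotient.lift PreForest.trees (fun _ _ h => PreForest.Rel.trees_eq h) f

theorem trees_zero : trees (0 : Forest A) = ∅ := rfl

theorem trees_node_add (a : A) (c r : Forest A) :
    trees (node a c + r) = insert (a, c) (trees r) := by
  obtain ⟨c⟩ := c
  obtain ⟨r⟩ := r
  rfl

theorem trees_node (a : A) (c : Forest A) : trees (node a c) = {(a, c)} := by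
  rw [← add_zero (node a c), trees_node_add, trees_zero, insert_empty_eq]

theorem trees_add (f g : Forest A) : trees (f + g) = trees f ∪ trees g := by
  induction f using Forest.induction with
  | zero => rw [zero_add, trees_zero, Set.empty_union]
  | node_add a c r _ ih => rw [add_assoc, trees_node_add, trees_node_add, ih, Set.insert_union]

theorem node_add_of_mem {a : A} {c f : Forest A} (h : (a, c) ∈ trees f) : node a c + f = f := by
  induction f using Forest.induction with
  | zero => exact absurd h (Set.notMem_empty _)
  | node_add b d r _ ih =>
    rw [trees_node_add] at h
    rcases h with h | h
    · obtain ⟨rfl, rfl⟩ := Prod.mk.inj h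
      rw [← add_assoc, add_self]
    · rw [add_left_comm, ih h]

theorem add_of_trees_subset {f g : Forest A} (h : trees f ⊆ trees g) : f + g = g := by
  induction f using Forest.induction with
  | zero => exact zero_add g
  | node_add a c r _ ih =>
    rw [trees_node_add, Set.insert_subset_iff] at h
    rw [add_assoc, ih h.2, node_add_of_mem h.1]

/-- A forest is determined by its set of trees. -/
theorem trees_injective {f g : Forest A} (h : trees f = trees g) : f = g := by
  rw [← add_of_trees_subset h.le, add_comm, add_of_trees_subset h.ge]

theorem height_lt_of_mem {a : A} {c f : Forest A} (h : (a, c) ∈ trees f) :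
    height c < height f := by
  have e := congrArg height (node_add_of_mem h)
  rw [height_add, height_node] at e
  omega

/-- There are forests of any height if there is a letter. -/
theorem exists_height_ge (a : A) (n : ℕ) : ∃ f : Forest A, n ≤ height f := by
  induction n with
  | zero => exact ⟨0, Nat.zero_le _⟩
  | succ n ih =>
    obtain ⟨f, hf⟩ := ih
    exact ⟨node a f, by rw [height_node]; omega⟩

/-- A summand whose trees are too high to occur in the rest of a sum can be cancelled. -/
theorem eq_of_add_node_eq {h k c d : Forest A} {a b : A} (hk : height k ≤ height c)
    (hh : height h ≤ height d) (e : h + node a c = k + node b d) : h = k ∧ a = b ∧ c = d := by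
  have et := congrArg trees e
  rw [trees_add, trees_add, trees_node, trees_node] at et
  have h₁ : (a, c) ∉ trees k := fun m => absurd (height_lt_of_mem m) (by omega)
  have h₂ : (b, d) ∉ trees h := fun m => absurd (height_lt_of_mem m) (by omega)
  have h₃ : (a, c) ∈ trees k ∪ {(b, d)} := et ▸ Or.inr rfl
  have h₄ : (a, c) = (b, d) := h₃.resolve_left h₁
  refine ⟨trees_injective ?_, (Prod.mk.inj h₄).1, (Prod.mk.inj h₄).2⟩
  rw [h₄] at et h₁
  ext t
  by_cases ht : t = (b, d)
  · rw [ht]; exact iff_of_false h₂ h₁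
  · have := Set.ext_iff.1 et t
    simpa [ht] using this

end Forest

/-- Contexts over the alphabet `A` (forests in which exactly one leaf is the variable `□`):
`hole h` is `h + □` and `node h a c` is `h + a[c]`. -/
inductive FContext (A : Type u) : Type u
  | hole (h : Forest A) : FContext A
  | node (h : Forest A) (a : A) (c : FContext A) : FContext A

namespace FContext

variable {A : Type u}

/-- The context `h + c`. -/
def addLeft (h : Forest A) : FContext A → FContext A
  | hole g => hole (h + g)
  | node g a c => node (h + g) a c

/-- The context obtained by replacing the variable of the first context by the second one. -/
def comp : FContext A → FContext A → FContext A
  | hole h, d => addLeft h d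
  | node h a c, d => node h a (comp c d)

/-- The forest obtained by inserting a forest at the variable of a context. -/
def plug : FContext A → Forest A → Forest A
  | hole h, f => h + f
  | node h a c, f => h + Forest.node a (plug c f)

theorem addLeft_addLeft (h g : Forest A) (c : FContext A) :
    addLeft h (addLeft g c) = addLeft (h + g) c := by
  cases c <;> simp only [addLeft, add_assoc]

theorem addLeft_zero (c : FContext A) : addLeft 0 c = c := by
  cases c <;> simp only [addLeft, zero_add]

theorem addLeft_comp (h : Forest A) (c d : FContext A) :
    comp (addLeft h c) d = addLeft h (comp c d) := by
  cases c with
  | hole g => exact (addLeft_addLeft h g d).symm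
  | node g a c => rfl

theorem plug_addLeft (h : Forest A) (c : FContext A) (f : Forest A) :
    plug (addLeft h c) f = h + plug c f := by
  cases c <;> simp only [addLeft, plug, add_assoc]

instance : Monoid (FContext A) where
  mul := comp
  one := hole 0
  mul_assoc c d e := by
    change comp (comp c d) e = comp c (comp d e)
    induction c with
    | hole h => simp only [comp, addLeft_comp]
    | node h a c ih => simp only [comp, ih]
  one_mul c := addLeft_zero c
  mul_one c := by
    change comp c (hole 0) = c
    induction c with
    | hole h => simp only [comp, addLeft, add_zero]
    | node h a c ih => simp only [comp, ih]

instance : MulAction (FContext A) (Forest A) where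
  smul := plug
  one_smul f := zero_add f
  mul_smul c d f := by
    change plug (comp c d) f = plug c (plug d f)
    induction c with
    | hole h => simp only [comp, plug, plug_addLeft]
    | node h a c ih => simp only [comp, plug, ih]

theorem height_le_plug (c : FContext A) (f : Forest A) :
    f.height ≤ (plug c f).height := by
  induction c with
  | hole h => rw [plug, Forest.height_add]; exact le_max_right _ _
  | node h a c ih => rw [plug, Forest.height_add, Forest.height_node]; omega

theorem eq_of_plug_eq (c d : FContext A) (N : ℕ)
    (hN : ∀ f : Forest A, N ≤ f.height → plug c f = plug d f) (a₀ : A) : c = d := by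
  have key : ∀ (h k : Forest A) (b : A) (d : FContext A) (N : ℕ),
      ¬ ∀ f : Forest A, N ≤ f.height → plug (hole h) f = plug (node k b d) f := by
    intro h k b d N hN
    obtain ⟨f, hf⟩ := Forest.exists_height_ge a₀ (max N (max h.height k.height))
    have e := congrArg Forest.height (hN f (by omega))
    have := height_le_plug d f
    simp only [plug, Forest.height_add, Forest.height_node] at e
    omega
  induction c generalizing d N with
  | hole h =>
    cases d with
    | hole k =>
      obtain ⟨f, hf⟩ := Forest.exists_height_ge a₀ (max N (max h.height k.height))
      have e := hN (Forest.node a₀ f) (by rw [Forest.height_node]; omega)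
      rw [(Forest.eq_of_add_node_eq (by omega) (by omega) e).1]
    | node k b d => exact absurd hN (key h k b d N)
  | node h a c ih =>
    cases d with
    | hole k => exact absurd (fun f hf => (hN f hf).symm) (key k h a c N)
    | node k b d =>
      have e : ∀ f : Forest A, max N (max h.height k.height) ≤ f.height →
          h = k ∧ a = b ∧ plug c f = plug d f := fun f hf =>
        Forest.eq_of_add_node_eq (by have := height_le_plug c f; omega)
          (by have := height_le_plug d f; omega) (hN f (by omega))
      obtain ⟨f, hf⟩ := Forest.exists_height_ge a₀ (max N (max h.height k.height))
      obtain ⟨rfl, rfl, -⟩ := e f hf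
      rw [ih d _ fun f hf => (e f hf).2.2]

instance : FaithfulSMul (FContext A) (Forest A) where
  eq_of_smul_eq_smul {c d} h := by
    rcases isEmpty_or_nonempty A with hA | ⟨⟨a₀⟩⟩
    · cases c with
      | node _ a _ => exact hA.elim a
      | hole g =>
        cases d with
        | node _ a _ => exact hA.elim a
        | hole k =>
          have e : g + 0 = k + 0 := h 0
          rw [add_zero, add_zero] at e
          rw [e]
    · exact eq_of_plug_eq c d 0 (fun f _ => h f) a₀

end FContext

/-- The free forest algebra `Σ^Δ = (H_Σ, V_Σ)` over the alphabet `A`. -/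
def freeForestAlg (A : Type u) : ForestAlg.{u} where
  H := Forest A
  V := FContext A
  add_self := Forest.add_self
  ins := FContext.hole
  ins_smul _ _ := rfl

/-- A forest algebra `F` recognizes a forest language `L` if there is a morphism `φ` from the free
forest algebra to `F` with `L = φ⁻¹(φ(L))`. -/
def ForestAlg.Recognizes (F : ForestAlg.{v}) {A : Type u} (L : Set (Forest A)) : Prop :=
  ∃ φ : (freeForestAlg A).Hom F, L = φ.mapH ⁻¹' (φ.mapH '' L)

/-- A forest language is regular if a finite forest algebra recognizes it. -/
def IsRegularForestLang {A : Type u} (L : Set (Forest A)) : Prop :=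
  ∃ F : ForestAlg.{u}, F.IsFinite ∧ F.Recognizes L

/-!
The two languages are unions of fibres of one additive map `φ` from forests to a finite commutative
monoid `H`, under which a letter `a` acts as a map `act a` (the product of the two recognizing
morphisms). It suffices to find a finite wreath product of distributive algebras such that two
forests with the same value there have the values under `φ` of two forests with equal pathsets.

*Claims and branches.* Let each node with the forest `c` below it claim a set `claims c` of values,
which contains `φ c`. A branch of a forest that ends in a leaf can be evaluated from the leaf
upwards, where at each node any claimed value may be added; this yields a set of values
(`Branch`). If `g` has this branch set, then `φ g` absorbs one of the values in it, since the node
may claim the value that is really there (`Branch.exists_mem`). Conversely, suppose that a forest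
`e` *honours* the claims: each claimed value is that of a forest all of whose paths are paths of
`e` below the node in question. Then each value in the branch set is that of a forest which
contains the branch and has no paths outside `e`. So if `f` and `g` agree in their claims and
branch sets, and if `f` can be enlarged to such an `e` with `φ e = φ f` and no new branch sets, then
a sum of forests of value `φ g` has the pathset of `e` (`exists_pathset_eq_of_branch`).

*The choice of the claims.* The claims have to be a function of the traces of the paths of `c` in a
finite set, so that a distributive algebra can compute them, and yet it must be possible to honour
them. Let `c` claim the values of the forests all of whose paths have the same profile as some path
of `c`, where the profile of a word says which transition systems on the finite set of decorated
types can read it. The transitions that matter lead from the decorated type of a forest to that of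
the forest below one of its roots. If all those which occur at height `n` also occur at smaller
heights, then the paths needed at height `n` can be assembled from enlargements of lower forests
(`exists_covers_of_run`), and the claims can be honoured by induction on the height (`full`). At
the heights where a new transition appears, `c` only claims the values of the forests all of whose
paths are paths of `c`, and nothing has to be done. There are finitely many such heights, and a
forest whose height is bounded has a pathset that can be computed exactly. So the claims only depend
on a finite amount of information on the single paths (`claims_eq_of_traces_eq`).

Hence the right factor of the wreath product computes the traces of the paths, and the middle
factor computes the branch sets, with access to the claims. This is enough, and the left factor is
trivial.
-/

/-! ### Pathsets and heights of forests -/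

namespace Forest

variable {A : Type u}

theorem pathset_add (f g : Forest A) : pathset (f + g) = pathset f ∪ pathset g := by
  induction f using Forest.induction with
  | zero =>
    have h : ([] : List A) ∈ pathset g := by
      induction g using Forest.induction with
      | zero => rfl
      | node_add a c r _ ih => rw [pathset_node_add]; exact Or.inr ih
    rw [zero_add, pathset_zero, Set.singleton_union, Set.insert_eq_of_mem h]
  | node_add a c r _ ih => rw [add_assoc, pathset_node_add, pathset_node_add, ih, Set.union_assoc]

theorem nil_mem_pathset (f : Forest A) : [] ∈ pathset f := by
  rw [← add_zero f, pathset_add]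
  exact Or.inr rfl

theorem pathset_node (a : A) (c : Forest A) :
    pathset (node a c) = List.cons a '' pathset c ∪ {[]} := by
  rw [← add_zero (node a c), pathset_node_add, pathset_zero]

theorem cons_mem_pathset_iff {f : Forest A} {a : A} {v : List A} :
    a :: v ∈ pathset f ↔ ∃ d, (a, d) ∈ trees f ∧ v ∈ pathset d := by
  induction f using Forest.induction with
  | zero => simp [pathset_zero, trees_zero]
  | node_add b c r _ ih =>
    rw [pathset_node_add, trees_node_add, Set.mem_union, ih]
    constructor
    · rintro (⟨w, hw, h⟩ | ⟨d, hd, hv⟩)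
      · obtain ⟨rfl, rfl⟩ := List.cons.inj h
        exact ⟨c, Or.inl rfl, hw⟩
      · exact ⟨d, Or.inr hd, hv⟩
    · rintro ⟨d, hd | hd, hv⟩
      · obtain ⟨rfl, rfl⟩ := Prod.mk.inj hd
        exact Or.inl ⟨v, hv, rfl⟩
      · exact Or.inr ⟨d, hd, hv⟩

theorem finite_pathset (f : Forest A) : (pathset f).Finite := by
  induction f using Forest.induction with
  | zero => exact Set.finite_singleton _
  | node_add a c r ihc ihr => rw [pathset_node_add]; exact (ihc.image _).union ihr

theorem length_le_height {f : Forest A} {v : List A} (hv : v ∈ pathset f) :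
    v.length ≤ height f := by
  induction v generalizing f with
  | nil => exact Nat.zero_le _
  | cons a v ih =>
    obtain ⟨d, hd, hv⟩ := cons_mem_pathset_iff.1 hv
    have := ih hv
    have := height_lt_of_mem hd
    simp only [List.length_cons]
    omega

theorem exists_length_eq_height (f : Forest A) : ∃ v ∈ pathset f, v.length = height f := by
  induction f using Forest.induction with
  | zero => exact ⟨[], rfl, rfl⟩
  | node_add a c r ihc ihr =>
    obtain ⟨v, hv, hvl⟩ := ihc
    obtain ⟨w, hw, hwl⟩ := ihr
    rw [height_add, height_node, pathset_node_add]
    rcases le_total (height c + 1) (height r) with h | h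
    · exact ⟨w, Or.inr hw, by rw [hwl, max_eq_right h]⟩
    · exact ⟨a :: v, Or.inl ⟨v, hv, rfl⟩, by rw [List.length_cons, hvl, max_eq_left h]⟩

theorem height_le_of_pathset_subset {f g : Forest A} (h : pathset f ⊆ pathset g) :
    height f ≤ height g := by
  obtain ⟨v, hv, hvl⟩ := exists_length_eq_height f
  rw [← hvl]
  exact length_le_height (h hv)

theorem exists_mem_trees {f : Forest A} (hf : f ≠ 0) : ∃ a d, (a, d) ∈ trees f := by
  induction f using Forest.induction with
  | zero => exact absurd rfl hf
  | node_add a c r _ _ => exact ⟨a, c, by rw [trees_node_add]; exact Or.inl rfl⟩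

end Forest

/-! ### The maximal distributive algebra of a powerset -/

namespace ForestAlg

/-- The subsets of `α`, as a type of its own because they are added by union. -/
def PowersetH (α : Type u) : Type u := Set α

instance (α : Type u) : Add (PowersetH α) := ⟨fun S T => (S ∪ T : Set α)⟩

instance (α : Type u) : Zero (PowersetH α) := ⟨(∅ : Set α)⟩

instance (α : Type u) : AddCommMonoid (PowersetH α) where
  add_assoc := Set.union_assoc (α := α)
  zero_add := Set.empty_union (α := α)
  add_zero := Set.union_empty (α := α)
  add_comm := Set.union_comm (α := α)
  nsmul := nsmulRec

/-- The maps of subsets of `α` that preserve binary unions. The empty set need not be fixed. -/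
@[ext] structure PowersetV (α : Type u) where
  /-- the map -/
  fn : Set α → Set α
  map_union : ∀ S T, fn (S ∪ T) = fn S ∪ fn T

instance (α : Type u) : Monoid (PowersetV α) where
  mul v w := ⟨v.fn ∘ w.fn, fun S T => by
    rw [Function.comp_apply, Function.comp_apply, Function.comp_apply, w.map_union, v.map_union]⟩
  one := ⟨id, fun _ _ => rfl⟩
  mul_assoc _ _ _ := rfl
  one_mul _ := rfl
  mul_one _ := rfl

instance (α : Type u) : MulAction (PowersetV α) (PowersetH α) where
  smul v S := v.fn S
  one_smul _ := rfl
  mul_smul _ _ _ := rfl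

instance (α : Type u) : FaithfulSMul (PowersetV α) (PowersetH α) :=
  ⟨fun h => PowersetV.ext (funext h)⟩

/-- The distributive forest algebra whose forest types are the subsets of `α`, added by union, and
whose context types are all maps of subsets that preserve binary unions. -/
def powerset (α : Type u) : ForestAlg.{u} where
  H := PowersetH α
  V := PowersetV α
  add_self := Set.union_self (α := α)
  ins S := ⟨fun T => (S ∪ T : Set α), Set.union_union_distrib_left (α := α) S⟩
  ins_smul _ _ := rfl

theorem powerset_isFinite (α : Type u) [Finite α] : (powerset α).IsFinite :=
  ⟨inferInstanceAs (Finite (Set α)),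
    Finite.of_injective (β := Set α → Set α) PowersetV.fn fun _ _ => PowersetV.ext⟩

theorem powerset_isDistributive (α : Type u) : (powerset α).IsDistributive :=
  fun v => PowersetV.map_union v

/-! ### Morphisms from the free forest algebra -/

theorem ins_add (F : ForestAlg.{v}) (g h : F.H) : F.ins (g + h) = F.ins g * F.ins h :=
  eq_of_smul_eq_smul (α := F.H) fun k => by
    rw [mul_smul, F.ins_smul, F.ins_smul, F.ins_smul, add_assoc]

theorem ins_zero (F : ForestAlg.{v}) : F.ins 0 = 1 :=
  eq_of_smul_eq_smul (α := F.H) fun k => by rw [F.ins_smul, zero_add, one_smul]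

variable {A : Type u} (F : ForestAlg.{v}) (letter : A → F.V)

/-- The value in `F` of an ordered forest, for a given interpretation of the letters. -/
def evalPre : PreForest A → F.H
  | .nil => 0
  | .cons a c r => letter a • evalPre c + evalPre r

theorem evalPre_eq {f g : PreForest A} (h : PreForest.Rel f g) :
    evalPre F letter f = evalPre F letter g := by
  induction h with
  | refl f => rfl
  | symm _ ih => exact ih.symm
  | trans _ _ ih₁ ih₂ => exact ih₁.trans ih₂
  | cons a _ _ ih₁ ih₂ => simp only [evalPre, ih₁, ih₂]
  | swap a b c d r => simp only [evalPre]; exact add_left_comm _ _ _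
  | dup a c r => simp only [evalPre, ← add_assoc, F.add_self]

/-- The value in `F` of a forest, for a given interpretation of the letters. -/
def eval : Forest A →+ F.H where
  toFun f := Quotient.lift (evalPre F letter) (fun _ _ h => evalPre_eq F letter h) f
  map_zero' := rfl
  map_add' := by
    rintro ⟨f⟩ ⟨g⟩
    change evalPre F letter (f.append g) = evalPre F letter f + evalPre F letter g
    induction f with
    | nil => exact (zero_add _).symm
    | cons a c r _ ih => simp only [PreForest.append, evalPre, ih, add_assoc]

theorem eval_node (a : A) (c : Forest A) :
    eval F letter (Forest.node a c) = letter a • eval F letter c := by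
  obtain ⟨c⟩ := c
  exact add_zero _

/-- The value in `F` of a context, for a given interpretation of the letters. -/
def evalContext : FContext A → F.V
  | .hole h => F.ins (eval F letter h)
  | .node h a c => F.ins (eval F letter h) * letter a * evalContext c

theorem evalContext_addLeft (h : Forest A) (c : FContext A) :
    evalContext F letter (c.addLeft h) = F.ins (eval F letter h) * evalContext F letter c := by
  cases c <;> simp only [FContext.addLeft, evalContext, map_add, ins_add, mul_assoc]

/-- Any interpretation of the letters as context types extends to a morphism from the free forest
algebra. -/
def freeHom : (freeForestAlg A).Hom F where
  mapH := eval F letter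
  mapV :=
    { toFun := evalContext F letter
      map_one' := by
        change F.ins (eval F letter 0) = 1
        rw [map_zero, ins_zero]
      map_mul' := by
        intro c d
        change evalContext F letter (FContext.comp c d) = _
        induction c with
        | hole h => exact evalContext_addLeft F letter h d
        | node h a c ih => simp only [FContext.comp, evalContext, ih, mul_assoc] }
  map_smul := by
    intro c (f : Forest A)
    change eval F letter (FContext.plug c f) = evalContext F letter c • eval F letter f
    induction c with
    | hole h =>
      change eval F letter (h + f) = F.ins (eval F letter h) • eval F letter f
      rw [map_add, F.ins_smul]
    | node h a c ih =>
      change eval F letter (h + Forest.node a (FContext.plug c f)) =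
        (F.ins (eval F letter h) * letter a * evalContext F letter c) • eval F letter f
      rw [map_add, eval_node, ih, mul_smul, mul_smul, F.ins_smul]
  map_ins _ := rfl

/-- In any morphism from the free forest algebra, a letter acts as the image of the context whose
only node is a root with that letter. -/
theorem Hom.mapH_node {F : ForestAlg.{v}} (φ : (freeForestAlg A).Hom F) (a : A) (c : Forest A) :
    φ.mapH (Forest.node a c) = φ.mapV (FContext.node 0 a (FContext.hole 0)) • φ.mapH c := by
  refine Eq.trans ?_ (φ.map_smul (FContext.node 0 a (FContext.hole 0)) c)
  have e : 0 + Forest.node a (0 + c) = Forest.node a c := by rw [zero_add, zero_add]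
  exact congrArg φ.mapH e.symm

end ForestAlg

/-! ### Words and transition systems -/

namespace PathSeparation

variable {A : Type u} {H : Type u}

/-- `Run D v t` says that the transition system `D` has a run on the word `v` from the state `t`. -/
def Run {T : Type u} (D : Set (T × A × T)) : List A → T → Prop
  | [], _ => True
  | a :: v, t => ∃ t', (t, a, t') ∈ D ∧ Run D v t'

/-- The profile of a word records, for all transition systems on the states `T` at once, from which
states they can read the word. -/
def profile (T : Type u) (v : List A) : Set (Set (T × A × T) × T) := {p | Run p.1 v p.2}

/-- How the profile of `v` determines that of `a :: v`. -/
def consProfile {T : Type u} (a : A) (P : Set (Set (T × A × T) × T)) :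
    Set (Set (T × A × T) × T) :=
  {p | ∃ t', (p.2, a, t') ∈ p.1 ∧ (p.1, t') ∈ P}

/-- Only the empty word can be read without transitions. -/
theorem eq_nil_of_profile_eq {T : Type u} [Nonempty T] {v : List A}
    (h : profile T v = profile T []) : v = [] := by
  obtain ⟨t⟩ := ‹Nonempty T›
  cases v with
  | nil => rfl
  | cons a v =>
    have h₁ : ((∅, t) : Set (T × A × T) × T) ∈ profile T (a :: v) := by
      rw [h]
      trivial
    obtain ⟨_, h₂, _⟩ := h₁
    exact absurd h₂ (Set.notMem_empty _)

/-! ### Claims -/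

section Claims

variable [AddCommMonoid H] (φ : Forest A →+ H) (act : A → H → H)

/-- The states of the transition systems that describe paths in forests: a value in `H`, and a set
of subsets of `H`. -/
abbrev Ty (H : Type u) : Type u := H × Set (Set H)

/-- The values claimed at a node with the forest `c` below it: those of the forests `s` all of whose
paths resemble a path of `c`. Two words resemble each other if they are equal, in case the height
of `c` belongs to the set `K` of exceptional heights, and if they have the same profile otherwise. -/
def claims (K : Set ℕ) (c : Forest A) : Set H :=
  {k | ∃ s, φ s = k ∧ ∀ v ∈ s.pathset, ∃ v' ∈ c.pathset,
    (c.height ∈ K → v = v') ∧ profile (Ty H) v = profile (Ty H) v'}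

theorem map_mem_claims (K : Set ℕ) (c : Forest A) : φ c ∈ claims φ K c :=
  ⟨c, rfl, fun v hv => ⟨v, hv, fun _ => rfl, rfl⟩⟩

/-- Given that a set `Y` of values can be attained below a node with label `a`, where the values in
`S` may be added first, these are the values that can be attained by the tree at the node. -/
def lift (a : A) (S Y : Set H) : Set H := {y | ∃ k ∈ S, ∃ x ∈ Y, y = act a (k + x)}

/-- The sets of values that are attained along the branches of a forest which end in a leaf: the
branch is evaluated from the leaf upwards, and at each inner node any claimed value may be added. -/
inductive Branch (K : Set ℕ) : Forest A → Set H → Prop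
  | zero : Branch K 0 {0}
  | node {c d : Forest A} {a : A} {X : Set H} : (a, d) ∈ c.trees → Branch K d X →
      Branch K c (lift act a (claims φ K d) X)

/-- The decorated type of a forest: its value, and the sets of values along its branches. The claims
of the forest itself do not enter, only those of the forests below its nodes. -/
def ty (K : Set ℕ) (c : Forest A) : Ty H := (φ c, {X | Branch φ act K c X})

/-- The transitions from the types of forests of height less than `n` to those of the forests below
their roots. -/
def transitions (K : Set ℕ) (n : ℕ) : Set (Ty H × A × Ty H) :=
  {δ | ∃ (c : Forest A) (a : A) (d : Forest A), c.height < n ∧ (a, d) ∈ c.trees ∧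
    δ = (ty φ act K c, a, ty φ act K d)}

theorem transitions_mono (K : Set ℕ) {m n : ℕ} (h : m ≤ n) :
    transitions φ act K m ⊆ transitions φ act K n := by
  rintro _ ⟨c, a, d, hc, hd, rfl⟩
  exact ⟨c, a, d, hc.trans_le h, hd, rfl⟩

theorem Branch.of_agree {K K' : Set ℕ} {c : Forest A} {X : Set H} (h : Branch φ act K c X)
    (hK : ∀ m < c.height, m ∈ K ↔ m ∈ K') : Branch φ act K' c X := by
  induction h with
  | zero => exact Branch.zero
  | @node c d a X hd _ ih =>
    have hlt := Forest.height_lt_of_mem hd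
    have e : claims φ K d = claims φ K' d := by simp only [claims, hK _ hlt]
    rw [e]
    exact Branch.node hd (ih fun m hm => hK m (hm.trans hlt))

theorem ty_eq_of_agree {K K' : Set ℕ} {c : Forest A} (hK : ∀ m < c.height, m ∈ K ↔ m ∈ K') :
    ty φ act K c = ty φ act K' c :=
  Prod.ext rfl (Set.ext fun _ => ⟨fun h => h.of_agree φ act hK,
    fun h => h.of_agree φ act fun m hm => (hK m hm).symm⟩)

theorem transitions_eq_of_agree {K K' : Set ℕ} {n : ℕ} (hK : ∀ m, m + 1 < n → (m ∈ K ↔ m ∈ K')) :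
    transitions φ act K n = transitions φ act K' n := by
  have e : ∀ c : Forest A, c.height < n → ty φ act K c = ty φ act K' c := fun c hc =>
    ty_eq_of_agree φ act fun m hm => hK m (by omega)
  ext δ
  constructor <;> rintro ⟨c, a, d, hc, hd, rfl⟩ <;>
    have hlt := Forest.height_lt_of_mem hd
  · exact ⟨c, a, d, hc, hd, by rw [e c hc, e d (hlt.trans hc)]⟩
  · exact ⟨c, a, d, hc, hd, by rw [e c hc, e d (hlt.trans hc)]⟩

/-- The exceptional heights can be chosen as those at which a new transition appears: whether `n` is
one of them only depends on the smaller ones. -/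
theorem exists_exceptional :
    ∃ K : Set ℕ, ∀ n, n ∈ K ↔ transitions φ act K (n + 1) ≠ transitions φ act K n := by
  let step : ∀ n : ℕ, (∀ m, m < n → Prop) → Prop := fun n ih =>
    transitions φ act {m | ∃ h : m < n, ih m h} (n + 1) ≠
      transitions φ act {m | ∃ h : m < n, ih m h} n
  let K : Set ℕ := {n | Nat.lt_wfRel.wf.fix step n}
  refine ⟨K, fun n => ?_⟩
  have h : n ∈ K ↔ step n fun m _ => m ∈ K := by
    change Nat.lt_wfRel.wf.fix step n ↔ _
    rw [WellFounded.fix_eq]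
    rfl
  have hK : ∀ m < n, m ∈ {m | ∃ _ : m < n, m ∈ K} ↔ m ∈ K := fun m hm =>
    ⟨fun h => h.2, fun h => ⟨hm, h⟩⟩
  rw [h, ← transitions_eq_of_agree φ act (n := n + 1) fun m hm => hK m (by omega),
    ← transitions_eq_of_agree φ act (n := n) fun m hm => hK m (by omega)]

theorem finite_exceptional [Finite A] [Finite H] {K : Set ℕ}
    (hK : ∀ n ∈ K, transitions φ act K (n + 1) ≠ transitions φ act K n) : K.Finite := by
  have h : ∀ n ∈ K, ∃ δ, δ ∈ transitions φ act K (n + 1) ∧ δ ∉ transitions φ act K n := by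
    intro n hn
    by_contra! h'
    exact hK n hn (Set.Subset.antisymm h' (transitions_mono φ act K n.le_succ))
  rcases K.eq_empty_or_nonempty with rfl | ⟨n, hn⟩
  · exact Set.finite_empty
  have : Nonempty (Ty H × A × Ty H) := ⟨(h n hn).choose⟩
  choose! δ hδ hδ' using h
  refine Set.Finite.of_finite_image (f := δ) (Set.toFinite _) ?_
  have key : ∀ m ∈ K, ∀ n ∈ K, δ m = δ n → ¬ m < n := fun m hm n hn e hlt =>
    hδ' n hn (transitions_mono φ act K hlt (e ▸ hδ m hm))
  intro m hm n hn e
  exact le_antisymm (not_lt.1 (key n hn m hm e.symm)) (not_lt.1 (key m hm n hn e))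

/-! ### Honouring the claims -/

variable {φ act} {K : Set ℕ}

/-- `Covers φ t e` says that `e` has the value of the decorated type `t`, and that for each path of
`e` some branch set of `t` consists of values of forests which contain the path and whose other
paths are paths of `e`. -/
def Covers (φ : Forest A →+ H) (t : Ty H) (e : Forest A) : Prop :=
  φ e = t.1 ∧ ∀ w ∈ e.pathset, ∃ X ∈ t.2, ∀ x ∈ X,
    ∃ g, φ g = x ∧ w ∈ g.pathset ∧ g.pathset ⊆ e.pathset

/-- `Honours φ S e` says that the values in `S` are those of forests whose paths are paths of
`e`. -/
def Honours (φ : Forest A →+ H) (S : Set H) (e : Forest A) : Prop :=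
  ∀ k ∈ S, ∃ s, φ s = k ∧ s.pathset ⊆ e.pathset

theorem Honours.mono {S : Set H} {e e' : Forest A} (h : Honours φ S e)
    (he : e.pathset ⊆ e'.pathset) : Honours φ S e' := fun k hk =>
  let ⟨s, hs, hse⟩ := h k hk
  ⟨s, hs, hse.trans he⟩

theorem Covers.add {t : Ty H} {e e' : Forest A} (h : Covers φ t e) (h' : Covers φ t e') :
    Covers φ t (e + e') := by
  refine ⟨?_, fun w hw => ?_⟩
  · rw [map_add, h'.1, ← h.1, ← map_add, Forest.add_self]
  rw [Forest.pathset_add] at hw ⊢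
  rcases hw with hw | hw
  · obtain ⟨X, hX, hg⟩ := h.2 w hw
    refine ⟨X, hX, fun x hx => ?_⟩
    obtain ⟨g, hgx, hgw, hge⟩ := hg x hx
    exact ⟨g, hgx, hgw, hge.trans Set.subset_union_left⟩
  · obtain ⟨X, hX, hg⟩ := h'.2 w hw
    refine ⟨X, hX, fun x hx => ?_⟩
    obtain ⟨g, hgx, hgw, hge⟩ := hg x hx
    exact ⟨g, hgx, hgw, hge.trans Set.subset_union_right⟩

/-- Finitely many words that can be put into covered forests of a type separately can be put into
one at the same time. -/
theorem Covers.exists_of_finite {t : Ty H} {e : Forest A} (he : Covers φ t e) {W : Set (List A)}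
    (hW : W.Finite) (h : ∀ w ∈ W, ∃ e, Covers φ t e ∧ w ∈ e.pathset) :
    ∃ e', Covers φ t e' ∧ e.pathset ⊆ e'.pathset ∧ W ⊆ e'.pathset := by
  induction W, hW using Set.Finite.induction_on with
  | empty => exact ⟨e, he, subset_rfl, Set.empty_subset _⟩
  | @insert w W _ _ ih =>
    obtain ⟨e₁, h₁, he₁, hW₁⟩ := ih fun w hw => h w (Or.inr hw)
    obtain ⟨e₂, h₂, hw₂⟩ := h w (Or.inl rfl)
    refine ⟨e₁ + e₂, h₁.add h₂, ?_, ?_⟩ <;> rw [Forest.pathset_add]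
    · exact he₁.trans Set.subset_union_left
    · exact Set.insert_subset (Or.inr hw₂) (hW₁.trans Set.subset_union_left)

/-- A covered forest below a new root: the values that are added at the root of the covered forest
come from the claims honoured there. -/
theorem Covers.node (hφ : ∀ a c, φ (Forest.node a c) = act a (φ c)) {d e : Forest A}
    (h : Covers φ (ty φ act K d) e) (hd : Honours φ (claims φ K d) e) (a : A) {w : List A}
    (hw : w ∈ e.pathset) :
    ∃ X, Branch φ act K d X ∧ ∀ y ∈ lift act a (claims φ K d) X,
      ∃ g, φ g = y ∧ a :: w ∈ g.pathset ∧ g.pathset ⊆ (Forest.node a e).pathset := by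
  obtain ⟨X, hX, hg⟩ := h.2 w hw
  refine ⟨X, hX, ?_⟩
  rintro y ⟨k, hk, x, hx, rfl⟩
  obtain ⟨s, rfl, hse⟩ := hd k hk
  obtain ⟨g, rfl, hgw, hge⟩ := hg x hx
  refine ⟨Forest.node a (s + g), by rw [hφ, map_add], ?_, ?_⟩
  · rw [Forest.pathset_node, Forest.pathset_add]
    exact Or.inl ⟨w, Or.inr hgw, rfl⟩
  · rw [Forest.pathset_node, Forest.pathset_node, Forest.pathset_add]
    exact Set.union_subset_union_left _ (Set.image_mono (Set.union_subset hse hge))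

/-- `Full φ act K c` says that `c` can be enlarged, without a change of its value, to a forest that
honours the claims of `c` and is covered for the decorated type of `c`. -/
def Full (φ : Forest A →+ H) (act : A → H → H) (K : Set ℕ) (c : Forest A) : Prop :=
  ∃ e, Covers φ (ty φ act K c) e ∧ Honours φ (claims φ K c) e ∧ c.pathset ⊆ e.pathset

/-- Words read by the transitions of low forests can be put into covered forests, since each
transition can be replaced by an enlargement of a low forest in which it occurs. -/
theorem exists_covers_of_run (hφ : ∀ a c, φ (Forest.node a c) = act a (φ c)) {n : ℕ}
    (hn : ∀ c : Forest A, c.height < n → Full φ act K c) {a : A} {v : List A} {t : Ty H}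
    (hv : Run (transitions φ act K n) (a :: v) t) :
    ∃ e, Covers φ t e ∧ a :: v ∈ e.pathset := by
  induction v generalizing a t with
  | nil =>
    obtain ⟨_, ⟨c, b, d, hc, hd, e⟩, _⟩ := hv
    cases e
    obtain ⟨e, he, _, hce⟩ := hn c hc
    exact ⟨e, he, hce (Forest.cons_mem_pathset_iff.2 ⟨d, hd, Forest.nil_mem_pathset d⟩)⟩
  | cons b v ih =>
    obtain ⟨_, ⟨c, b', d, hc, hd, e⟩, hv⟩ := hv
    cases e
    obtain ⟨e₁, he₁, hve₁⟩ := ih hv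
    obtain ⟨e₂, he₂, hde₂, _⟩ := hn d ((Forest.height_lt_of_mem hd).trans hc)
    obtain ⟨e₀, he₀, _⟩ := hn c hc
    have hs : (e₁ + e₂).pathset = e₁.pathset ∪ e₂.pathset := Forest.pathset_add _ _
    have key := fun w hw => (he₁.add he₂).node hφ (hde₂.mono (by rw [hs]; exact
      Set.subset_union_right)) a (w := w) hw
    have ha : (e₀ + Forest.node a (e₁ + e₂)).pathset =
      e₀.pathset ∪ (Forest.node a (e₁ + e₂)).pathset := Forest.pathset_add _ _
    refine ⟨e₀ + Forest.node a (e₁ + e₂), ⟨?_, ?_⟩, ?_⟩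
    · rw [map_add, hφ, (he₁.add he₂).1, he₀.1]
      change φ c + act a (φ d) = φ c
      rw [← hφ, ← map_add, add_comm, Forest.node_add_of_mem hd]
    · intro w hw
      rw [ha, Forest.pathset_node] at hw
      rw [ha]
      rcases hw with hw | ⟨w, hw, rfl⟩ | rfl
      · obtain ⟨X, hX, hg⟩ := he₀.2 w hw
        refine ⟨X, hX, fun x hx => ?_⟩
        obtain ⟨g, hgx, hgw, hge⟩ := hg x hx
        exact ⟨g, hgx, hgw, hge.trans Set.subset_union_left⟩
      · obtain ⟨X, hX, hg⟩ := key w hw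
        refine ⟨_, Branch.node hd hX, fun x hx => ?_⟩
        obtain ⟨g, hgx, hgw, hge⟩ := hg x hx
        exact ⟨g, hgx, hgw, hge.trans Set.subset_union_right⟩
      · obtain ⟨X, hX, hg⟩ := he₀.2 [] (Forest.nil_mem_pathset _)
        refine ⟨X, hX, fun x hx => ?_⟩
        obtain ⟨g, hgx, hgw, hge⟩ := hg x hx
        exact ⟨g, hgx, hgw, hge.trans Set.subset_union_left⟩
    · rw [ha, Forest.pathset_node, hs]
      exact Or.inr (Or.inl ⟨_, Or.inl hve₁, rfl⟩)

/-- Enlarging all trees of a forest. -/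
theorem exists_graft (hφ : ∀ a c, φ (Forest.node a c) = act a (φ c)) {r : Forest A}
    (hr : ∀ a d, (a, d) ∈ r.trees → Full φ act K d) :
    ∃ e, φ e = φ r ∧ r.pathset ⊆ e.pathset ∧ ∀ w ∈ e.pathset, w = [] ∨
      ∃ a d X, (a, d) ∈ r.trees ∧ Branch φ act K d X ∧ ∀ y ∈ lift act a (claims φ K d) X,
        ∃ g, φ g = y ∧ w ∈ g.pathset ∧ g.pathset ⊆ e.pathset := by
  induction r using Forest.induction with
  | zero => exact ⟨0, rfl, subset_rfl, fun w hw => Or.inl hw⟩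
  | node_add a c r _ ih =>
    obtain ⟨e₁, he₁, hre₁, hg₁⟩ := ih fun b d hd => hr b d (by
      rw [Forest.trees_node_add]; exact Or.inr hd)
    obtain ⟨e₂, he₂, hce₂, hse₂⟩ := hr a c (by rw [Forest.trees_node_add]; exact Or.inl rfl)
    have hs : (Forest.node a e₂ + e₁).pathset = (Forest.node a e₂).pathset ∪ e₁.pathset :=
      Forest.pathset_add _ _
    refine ⟨Forest.node a e₂ + e₁, ?_, ?_, fun w hw => ?_⟩
    · rw [map_add, map_add, hφ, hφ, he₁, he₂.1]
      rfl
    · rw [hs, Forest.pathset_node, Forest.pathset_node_add]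
      exact Set.union_subset_union ((Set.image_mono hse₂).trans Set.subset_union_left) hre₁
    · rw [hs, Forest.pathset_node] at hw
      rw [hs]
      rcases hw with (⟨w, hw, rfl⟩ | rfl) | hw
      · obtain ⟨X, hX, hg⟩ := he₂.node hφ hce₂ a hw
        refine Or.inr ⟨a, c, X, by rw [Forest.trees_node_add]; exact Or.inl rfl, hX,
          fun y hy => ?_⟩
        obtain ⟨g, hgy, hgw, hge⟩ := hg y hy
        exact ⟨g, hgy, hgw, hge.trans Set.subset_union_left⟩
      · exact Or.inl rfl
      · rcases hg₁ w hw with rfl | ⟨b, d, X, hd, hX, hg⟩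
        · exact Or.inl rfl
        refine Or.inr ⟨b, d, X, by rw [Forest.trees_node_add]; exact Or.inr hd, hX,
          fun y hy => ?_⟩
        obtain ⟨g, hgy, hgw, hge⟩ := hg y hy
        exact ⟨g, hgy, hgw, hge.trans Set.subset_union_right⟩

theorem run_of_mem_pathset {n : ℕ} {c : Forest A} (hc : c.height < n) {v : List A}
    (hv : v ∈ c.pathset) : Run (transitions φ act K n) v (ty φ act K c) := by
  induction v generalizing c with
  | nil => trivial
  | cons a v ih =>
    obtain ⟨d, hd, hv⟩ := Forest.cons_mem_pathset_iff.1 hv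
    exact ⟨_, ⟨c, a, d, hc, hd, rfl⟩, ih ((Forest.height_lt_of_mem hd).trans hc) hv⟩

theorem full_zero : Full φ act K 0 := by
  refine ⟨0, ⟨rfl, fun w hw => ⟨{0}, Branch.zero, ?_⟩⟩, ?_, subset_rfl⟩
  · rintro _ rfl
    exact ⟨0, map_zero φ, hw, subset_rfl⟩
  · rintro k ⟨s, hs, hv⟩
    refine ⟨s, hs, fun v hvs => ?_⟩
    obtain ⟨v', rfl, _, he⟩ := hv v hvs
    exact eq_nil_of_profile_eq he

/-- All claims can be honoured. At an exceptional height, the claims made are already honoured by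
the forest itself. At the other heights, the paths which the claims require can be read by
transitions of lower forests. -/
theorem full [Finite H] (hφ : ∀ a c, φ (Forest.node a c) = act a (φ c))
    (hK : ∀ n, n ∈ K ↔ transitions φ act K (n + 1) ≠ transitions φ act K n) (c : Forest A) :
    Full φ act K c := by
  induction hn : c.height using Nat.strong_induction_on generalizing c with
  | _ n ih =>
    by_cases hc0 : c = 0
    · rw [hc0]
      exact full_zero
    obtain ⟨e, he, hce, hg⟩ := exists_graft (K := K) (r := c) hφ fun a d hd =>
      ih _ (hn ▸ Forest.height_lt_of_mem hd) d rfl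
    have hcov : Covers φ (ty φ act K c) e := by
      refine ⟨he, fun w hw => ?_⟩
      rcases hg w hw with rfl | ⟨a, d, X, hd, hX, hg⟩
      · -- The empty path is part of any longer one.
        obtain ⟨a, d, hd⟩ := Forest.exists_mem_trees hc0
        have hw' : [a] ∈ e.pathset :=
          hce (Forest.cons_mem_pathset_iff.2 ⟨d, hd, Forest.nil_mem_pathset d⟩)
        rcases hg _ hw' with h | ⟨a, d, X, hd, hX, hg⟩
        · exact absurd h (List.cons_ne_nil _ _)
        refine ⟨_, Branch.node hd hX, fun y hy => ?_⟩
        obtain ⟨g, hgy, -, hge⟩ := hg y hy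
        exact ⟨g, hgy, Forest.nil_mem_pathset g, hge⟩
      · exact ⟨_, Branch.node hd hX, hg⟩
    -- It remains to honour the claims of `c` itself.
    by_cases hnK : n ∈ K
    · refine ⟨e, hcov, ?_, hce⟩
      rintro k ⟨s, hs, hv⟩
      refine ⟨s, hs, fun v hvs => ?_⟩
      obtain ⟨v', hv', h, _⟩ := hv v hvs
      rw [h (hn.symm ▸ hnK)]
      exact hce hv'
    · have hcl : ∀ k ∈ claims φ K c, ∃ s, φ s = k ∧ ∀ v ∈ s.pathset,
          ∃ e, Covers φ (ty φ act K c) e ∧ v ∈ e.pathset := by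
        rintro k ⟨s, hs, hv⟩
        refine ⟨s, hs, fun v hvs => ?_⟩
        obtain ⟨v', hv', _, h⟩ := hv v hvs
        cases v with
        | nil => exact ⟨e, hcov, Forest.nil_mem_pathset e⟩
        | cons a v =>
          -- No transition first appears at height `n`, so `v'` is read by those of lower forests,
          -- and so is `v`, which has the same profile.
          have hr : Run (transitions φ act K n) v' (ty φ act K c) := by
            rw [← not_ne_iff.1 (mt (hK n).2 hnK)]
            exact run_of_mem_pathset (by omega) hv'
          have hr' : (transitions φ act K n, ty φ act K c) ∈ profile (Ty H) (a :: v) := by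
            rw [h]
            exact hr
          exact exists_covers_of_run hφ (fun d hd => ih _ hd d rfl) hr'
      choose! s hs hsv using hcl
      obtain ⟨e', he', hee', hW⟩ := hcov.exists_of_finite
        (W := ⋃ k ∈ claims φ K c, (s k).pathset)
        ((Set.toFinite _).biUnion fun k _ => (s k).finite_pathset) fun w hw => by
          obtain ⟨k, hk, hw⟩ := Set.mem_iUnion₂.1 hw
          exact hsv k hk w hw
      exact ⟨e', he', fun k hk => ⟨s k, hs k hk, fun w hw => hW (Set.mem_iUnion₂.2 ⟨k, hk, hw⟩)⟩,
        hce.trans hee'⟩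

/-- The value of a forest absorbs a value from each branch set, as each node may claim the value of
the forest below it. -/
theorem Branch.exists_mem (hφ : ∀ a c, φ (Forest.node a c) = act a (φ c)) {c : Forest A}
    {X : Set H} (h : Branch φ act K c X) : ∃ x ∈ X, φ c + x = φ c := by
  induction h with
  | zero => exact ⟨0, rfl, add_zero _⟩
  | @node c d a X hd _ ih =>
    obtain ⟨x, hx, hdx⟩ := ih
    refine ⟨_, ⟨φ d, map_mem_claims φ K d, x, hx, rfl⟩, ?_⟩
    rw [hdx, ← hφ, ← map_add, add_comm, Forest.node_add_of_mem hd]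

/-- A forest such that each of its paths lies in a forest of value `h` with no other paths has the
same paths as some forest of value `h`. -/
theorem exists_pathset_eq {e : Forest A} {h : H}
    (hw : ∀ w ∈ e.pathset, ∃ g, φ g = h ∧ w ∈ g.pathset ∧ g.pathset ⊆ e.pathset) :
    ∃ g, φ g = h ∧ g.pathset = e.pathset := by
  have key : ∀ W : Set (List A), W.Finite → W ⊆ e.pathset →
      ∃ g, φ g = h ∧ W ⊆ g.pathset ∧ g.pathset ⊆ e.pathset := by
    intro W hW
    induction W, hW using Set.Finite.induction_on with
    | empty =>
      intro _
      obtain ⟨g, hg, -, hge⟩ := hw [] (Forest.nil_mem_pathset e)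
      exact ⟨g, hg, Set.empty_subset _, hge⟩
    | @insert w W _ _ ih =>
      intro hWe
      rw [Set.insert_subset_iff] at hWe
      obtain ⟨g₁, hg₁, hW₁, hge₁⟩ := ih hWe.2
      obtain ⟨g₂, hg₂, hw₂, hge₂⟩ := hw w hWe.1
      refine ⟨g₁ + g₂, ?_, ?_, ?_⟩
      · rw [map_add, hg₁, ← hg₂, ← map_add, Forest.add_self]
      · rw [Forest.pathset_add]
        exact Set.insert_subset (Or.inr hw₂) (hW₁.trans Set.subset_union_left)
      · rw [Forest.pathset_add]
        exact Set.union_subset hge₁ hge₂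
  obtain ⟨g, hg, h₁, h₂⟩ := key _ e.finite_pathset subset_rfl
  exact ⟨g, hg, h₂.antisymm h₁⟩

/-- Forests with the same claims at the root and the same branch sets have the values of forests
with equal pathsets. -/
theorem exists_pathset_eq_of_branch [Finite H] (hφ : ∀ a c, φ (Forest.node a c) = act a (φ c))
    (hK : ∀ n, n ∈ K ↔ transitions φ act K (n + 1) ≠ transitions φ act K n) {f g : Forest A}
    (hcl : claims φ K f = claims φ K g) (hbr : ∀ X, Branch φ act K f X → Branch φ act K g X) :
    ∃ f' g', φ f' = φ f ∧ φ g' = φ g ∧ f'.pathset = g'.pathset := by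
  obtain ⟨e, he, hh, -⟩ := full hφ hK f
  obtain ⟨s, hs, hse⟩ := hh (φ g) (hcl ▸ map_mem_claims φ K g)
  have hw : ∀ w ∈ e.pathset, ∃ g', φ g' = φ g ∧ w ∈ g'.pathset ∧ g'.pathset ⊆ e.pathset := by
    intro w hw
    obtain ⟨X, hX, hg⟩ := he.2 w hw
    obtain ⟨x, hx, hgx⟩ := (hbr X hX).exists_mem hφ
    obtain ⟨g', rfl, hwg', hge⟩ := hg x hx
    refine ⟨s + g', by rw [map_add, hs, hgx], ?_, ?_⟩ <;> rw [Forest.pathset_add]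
    · exact Or.inr hwg'
    · exact Set.union_subset hse hge
  obtain ⟨g', hg', hge⟩ := exists_pathset_eq hw
  exact ⟨e, g', he.1, hg', hge.symm⟩

end Claims

end PathSeparation

/-! ### Computing the claims and the branch sets -/

namespace PathSeparation

variable {A : Type u} {H : Type u}

/-- What is recorded of a word: its profile, and its prefix of length at most `N`. -/
abbrev Trace (A H : Type u) (N : ℕ) : Type u :=
  Set (Set (Ty H × A × Ty H) × Ty H) × {l : List A // l.length ≤ N}

/-- The trace of a word. -/
def trace (H : Type u) (N : ℕ) (v : List A) : Trace A H N :=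
  (profile (Ty H) v, ⟨v.take N, List.length_take_le N v⟩)

/-- How the trace of `v` determines that of `a :: v`. -/
def consTrace {N : ℕ} (a : A) (p : Trace A H N) : Trace A H N :=
  (consProfile a p.1, ⟨(a :: p.2.1).take N, List.length_take_le _ _⟩)

theorem trace_cons (N : ℕ) (a : A) (v : List A) :
    trace H N (a :: v) = consTrace a (trace H N v) := by
  refine Prod.ext rfl (Subtype.ext ?_)
  cases N with
  | zero => rfl
  | succ N => simp [trace, consTrace, List.take_take]

/-- The traces of the nonempty paths of a forest. -/
def traces (H : Type u) (N : ℕ) (c : Forest A) : Set (Trace A H N) :=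
  {p | ∃ v ∈ c.pathset, v ≠ [] ∧ trace H N v = p}

theorem traces_zero (N : ℕ) : traces H N (0 : Forest A) = ∅ := by
  ext p
  refine iff_of_false ?_ (Set.notMem_empty p)
  rintro ⟨v, hv, hne, -⟩
  exact hne hv

theorem traces_eq_empty_iff {N : ℕ} {c : Forest A} : traces H N c = ∅ ↔ c = 0 := by
  refine ⟨fun h => ?_, fun h => h ▸ traces_zero N⟩
  by_contra hc
  obtain ⟨a, d, hd⟩ := Forest.exists_mem_trees hc
  have h' : trace H N [a] ∈ traces H N c :=
    ⟨[a], Forest.cons_mem_pathset_iff.2 ⟨d, hd, Forest.nil_mem_pathset d⟩, List.cons_ne_nil _ _, rfl⟩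
  rw [h] at h'
  exact h'

theorem traces_node_add (N : ℕ) (a : A) (c r : Forest A) :
    traces H N (Forest.node a c + r) =
      insert (consTrace a (trace H N [])) (consTrace a '' traces H N c) ∪ traces H N r := by
  ext p
  constructor
  · rintro ⟨v, hv, hne, rfl⟩
    rw [Forest.pathset_node_add] at hv
    rcases hv with ⟨v, hv, rfl⟩ | hv
    · refine Or.inl ?_
      rw [trace_cons]
      rcases eq_or_ne v [] with rfl | hne
      · exact Or.inl rfl
      · exact Or.inr ⟨_, ⟨v, hv, hne, rfl⟩, rfl⟩
    · exact Or.inr ⟨v, hv, hne, rfl⟩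
  · have key : ∀ v ∈ c.pathset, consTrace a (trace H N v) ∈ traces H N (Forest.node a c + r) :=
      fun v hv => ⟨a :: v, by rw [Forest.pathset_node_add]; exact Or.inl ⟨v, hv, rfl⟩,
        List.cons_ne_nil _ _, trace_cons N a v⟩
    rintro ((rfl | ⟨_, ⟨v, hv, -, rfl⟩, rfl⟩) | ⟨v, hv, hne, rfl⟩)
    · exact key [] (Forest.nil_mem_pathset c)
    · exact key v hv
    · exact ⟨v, by rw [Forest.pathset_node_add]; exact Or.inr hv, hne, rfl⟩

/-- The traces include those of the empty path. -/
theorem exists_trace_eq {N : ℕ} {c c' : Forest A} (h : traces H N c = traces H N c') {v : List A}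
    (hv : v ∈ c.pathset) : ∃ v' ∈ c'.pathset, trace H N v = trace H N v' := by
  rcases eq_or_ne v [] with rfl | hne
  · exact ⟨[], Forest.nil_mem_pathset c', rfl⟩
  · have hp : trace H N v ∈ traces H N c' := h ▸ ⟨v, hv, hne, rfl⟩
    obtain ⟨v', hv', -, e⟩ := hp
    exact ⟨v', hv', e.symm⟩

/-- A word shorter than `N` is determined by its trace. -/
theorem eq_of_trace_eq {N : ℕ} {v v' : List A} (h : trace H N v = trace H N v')
    (hv : v.length < N) : v = v' := by
  have e : v.take N = v'.take N := congrArg (fun p : Trace A H N => p.2.1) h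
  rw [List.take_of_length_le hv.le] at e
  rw [e, List.length_take] at hv
  rw [e, List.take_of_length_le (by omega)]

theorem pathset_eq_of_traces_eq {N : ℕ} {c c' : Forest A} (h : traces H N c = traces H N c')
    (hc : c.height < N) : c.pathset = c'.pathset := by
  have hl : ∀ v ∈ c.pathset, v.length < N := fun v hv =>
    (Forest.length_le_height hv).trans_lt hc
  refine Set.Subset.antisymm (fun v hv => ?_) fun v hv => ?_
  · obtain ⟨v', hv', e⟩ := exists_trace_eq h hv
    rwa [eq_of_trace_eq e (hl v hv)]
  · obtain ⟨v', hv', e⟩ := exists_trace_eq h.symm hv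
    rwa [← eq_of_trace_eq e.symm (hl v' hv')]

section Claims

variable [AddCommMonoid H] (φ : Forest A →+ H) (act : A → H → H) {K : Set ℕ} {N : ℕ}

/-- The claims are a function of the traces, if all exceptional heights are less than `N`. -/
theorem claims_eq_of_traces_eq (hK : ∀ n ∈ K, n < N) {c c' : Forest A}
    (h : traces H N c = traces H N c') : claims φ K c = claims φ K c' := by
  have key : ∀ c c' : Forest A, traces H N c = traces H N c' → claims φ K c ⊆ claims φ K c' := by
    rintro c c' h k ⟨s, hs, hv⟩
    refine ⟨s, hs, fun v hvs => ?_⟩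
    obtain ⟨v', hv', h₁, h₂⟩ := hv v hvs
    by_cases hc : c'.height ∈ K
    · have e := pathset_eq_of_traces_eq h.symm (hK _ hc)
      have eh : c.height = c'.height := le_antisymm (Forest.height_le_of_pathset_subset e.ge)
        (Forest.height_le_of_pathset_subset e.le)
      exact ⟨v', e ▸ hv', fun _ => h₁ (eh ▸ hc), h₂⟩
    · obtain ⟨v'', hv'', e⟩ := exists_trace_eq h hv'
      exact ⟨v'', hv'', fun h => absurd h hc, h₂.trans (congrArg Prod.fst e)⟩
  exact Set.Subset.antisymm (key c c' h) (key c' c h.symm)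

/-- The claims, as a function of the traces. -/
def claimsOfTraces (K : Set ℕ) (S : Set (Trace A H N)) : Set H :=
  {k | ∃ c : Forest A, traces H N c = S ∧ k ∈ claims φ K c}

theorem claimsOfTraces_traces (hK : ∀ n ∈ K, n < N) (c : Forest A) :
    claimsOfTraces φ K (traces H N c) = claims φ K c := by
  refine Set.Subset.antisymm ?_ fun k hk => ⟨c, rfl, hk⟩
  rintro k ⟨c', h, hk⟩
  rwa [← claims_eq_of_traces_eq φ hK h]

/-- The branch sets of a forest that come from nonempty branches. -/
def properBranches (K : Set ℕ) (c : Forest A) : Set (Set H) :=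
  {Y | ∃ a d X, (a, d) ∈ c.trees ∧ Branch φ act K d X ∧ Y = lift act a (claims φ K d) X}

theorem branch_iff {c : Forest A} {X : Set H} :
    Branch φ act K c X ↔ X ∈ properBranches φ act K c ∨ c = 0 ∧ X = {0} := by
  constructor
  · rintro (_ | ⟨hd, hX⟩)
    · exact Or.inr ⟨rfl, rfl⟩
    · exact Or.inl ⟨_, _, _, hd, hX, rfl⟩
  · rintro (⟨a, d, X, hd, hX, rfl⟩ | ⟨rfl, rfl⟩)
    · exact Branch.node hd hX
    · exact Branch.zero

theorem properBranches_zero : properBranches φ act K (0 : Forest A) = ∅ := by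
  ext X
  refine iff_of_false ?_ (Set.notMem_empty X)
  rintro ⟨a, d, _, hd, -⟩
  exact hd

/-- The transformation of branch sets by a node with label `a`, given the traces `S` of the forest
below the node. -/
def branchStep (K : Set ℕ) (a : A) (S : Set (Trace A H N)) (B : Set (Set H)) : Set (Set H) :=
  lift act a (claimsOfTraces φ K S) '' (B ∪ {X | S = ∅ ∧ X = {0}})

theorem properBranches_node_add (hK : ∀ n ∈ K, n < N) (a : A) (c r : Forest A) :
    properBranches φ act K (Forest.node a c + r) =
      branchStep φ act K a (traces H N c) (properBranches φ act K c) ∪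
        properBranches φ act K r := by
  have hb : ∀ X, X ∈ properBranches φ act K c ∪ {X | traces H N c = ∅ ∧ X = {0}} ↔
      Branch φ act K c X := fun X => by
    rw [branch_iff, ← traces_eq_empty_iff (H := H) (N := N)]
    rfl
  rw [branchStep, claimsOfTraces_traces φ hK]
  ext Y
  constructor
  · rintro ⟨b, d, X, hd, hX, rfl⟩
    rw [Forest.trees_node_add] at hd
    rcases hd with hd | hd
    · obtain ⟨rfl, rfl⟩ := Prod.mk.inj hd
      exact Or.inl ⟨X, (hb X).2 hX, rfl⟩
    · exact Or.inr ⟨b, d, X, hd, hX, rfl⟩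
  · rintro (⟨X, hX, rfl⟩ | ⟨b, d, X, hd, hX, rfl⟩)
    · exact ⟨a, c, X, by rw [Forest.trees_node_add]; exact Or.inl rfl, (hb X).1 hX, rfl⟩
    · exact ⟨b, d, X, by rw [Forest.trees_node_add]; exact Or.inr hd, hX, rfl⟩

end Claims

/-! ### The wreath product -/

section Wreath

open ForestAlg

variable [AddCommMonoid H] (φ : Forest A →+ H) (act : A → H → H) (K : Set ℕ) (N : ℕ)

/-- The wreath product whose right factor computes traces and whose middle factor computes branch
sets. No information is kept in the left factor. -/
abbrev separator (A H : Type u) (N : ℕ) : ForestAlg.{u} :=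
  (powerset PEmpty.{u + 1}).wreath
    ((powerset (Set H)).wreath (powerset (Trace A H N)))

/-- The letters as context types of the wreath product. -/
def separatorLetter (a : A) : (separator A H N).V :=
  WreathV.mk (fun _ => 1) (WreathV.mk
    (fun S => PowersetV.mk (branchStep φ act K a S) fun B C =>
      (congrArg _ (Set.union_union_distrib_right B C _)).trans (Set.image_union _ _ _))
    (PowersetV.mk (fun S => insert (consTrace a (trace H N [])) (consTrace a '' S)) fun S T => by
      rw [Set.image_union, Set.insert_union_distrib]))

theorem eval_separatorLetter (hK : ∀ n ∈ K, n < N) (f : Forest A) :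
    (eval (separator A H N) (separatorLetter φ act K N) f).2 =
      (properBranches φ act K f, traces H N f) := by
  induction f using Forest.induction with
  | zero =>
    rw [map_zero, properBranches_zero, traces_zero]
    rfl
  | node_add a c r ihc ihr =>
    rw [map_add, eval_node, properBranches_node_add φ act hK, traces_node_add]
    change ((separatorLetter φ act K N a).ctx •
      (eval (separator A H N) (separatorLetter φ act K N) c).2 +
        (eval (separator A H N) (separatorLetter φ act K N) r).2 :
          ((powerset (Set H)).wreath (powerset (Trace A H N))).H) = _
    rw [ihc, ihr]
    rfl

/-- Forests with the same value in the wreath product have the values in `H` of forests with equal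
pathsets. -/
theorem exists_pathset_eq_of_eval_eq {φ} {act} {K} [Finite H]
    (hφ : ∀ a c, φ (Forest.node a c) = act a (φ c))
    (hK : ∀ n, n ∈ K ↔ transitions φ act K (n + 1) ≠ transitions φ act K n)
    (hN : ∀ n ∈ K, n < N) {f g : Forest A}
    (h : eval (separator A H N) (separatorLetter φ act K N) f =
      eval (separator A H N) (separatorLetter φ act K N) g) :
    ∃ f' g', φ f' = φ f ∧ φ g' = φ g ∧ f'.pathset = g'.pathset := by
  have e := congrArg Prod.snd h
  rw [eval_separatorLetter φ act K N hN, eval_separatorLetter φ act K N hN] at e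
  obtain ⟨hb, ht⟩ := Prod.mk.inj e
  refine exists_pathset_eq_of_branch hφ hK (claims_eq_of_traces_eq φ hN ht) fun X hX => ?_
  rwa [branch_iff, ← hb, ← traces_eq_empty_iff (H := H) (N := N), ← ht, traces_eq_empty_iff,
    ← branch_iff]

end Wreath

end PathSeparation

open PathSeparation in
theorem mainTheorem3 {A : Type u} [Finite A] (L₁ L₂ : Set (Forest A))
    (hL₁ : IsRegularForestLang L₁) (hL₂ : IsRegularForestLang L₂)
    (hπ : (Forest.pathset '' L₁) ∩ (Forest.pathset '' L₂) = ∅) :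
    ∃ F₁ F₂ F₃ : ForestAlg.{u},
      (F₁.IsFinite ∧ F₁.IsDistributive) ∧
      (F₂.IsFinite ∧ F₂.IsDistributive) ∧
      (F₃.IsFinite ∧ F₃.IsDistributive) ∧
      ∃ X : Set (Forest A),
        (F₁.wreath (F₂.wreath F₃)).Recognizes X ∧ L₁ ⊆ X ∧ X ⊆ L₂ᶜ := by
  obtain ⟨G₁, ⟨_, _⟩, φ₁, h₁⟩ := hL₁
  obtain ⟨G₂, ⟨_, _⟩, φ₂, h₂⟩ := hL₂
  -- Both languages are unions of fibres of `φ`.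
  let φ : Forest A →+ G₁.H × G₂.H := AddMonoidHom.prod φ₁.mapH φ₂.mapH
  let letter : A → FContext A := fun a => FContext.node 0 a (FContext.hole 0)
  let act : A → G₁.H × G₂.H → G₁.H × G₂.H := fun a h =>
    (φ₁.mapV (letter a) • h.1, φ₂.mapV (letter a) • h.2)
  have hφ : ∀ a c, φ (Forest.node a c) = act a (φ c) := fun a c =>
    Prod.ext (φ₁.mapH_node a c) (φ₂.mapH_node a c)
  obtain ⟨K, hK⟩ := exists_exceptional φ act
  obtain ⟨N, hN⟩ := (finite_exceptional φ act fun n hn => (hK n).1 hn).bddAbove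
  have hN' : ∀ n ∈ K, n < N + 1 := fun n hn => Nat.lt_succ_of_le (hN hn)
  have : Finite {l : List A // l.length ≤ N + 1} := List.finite_length_le A (N + 1)
  let ψ := ForestAlg.freeHom _ (separatorLetter φ act K (N + 1))
  refine ⟨_, _, _,
    ⟨ForestAlg.powerset_isFinite PEmpty, ForestAlg.powerset_isDistributive _⟩,
    ⟨ForestAlg.powerset_isFinite (Set (G₁.H × G₂.H)), ForestAlg.powerset_isDistributive _⟩,
    ⟨ForestAlg.powerset_isFinite (Trace A (G₁.H × G₂.H) (N + 1)),
      ForestAlg.powerset_isDistributive _⟩,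
    ψ.mapH ⁻¹' (ψ.mapH '' L₁), ⟨ψ, ?_⟩, Set.subset_preimage_image _ _, ?_⟩
  · exact (congrArg (ψ.mapH ⁻¹' ·) (Set.image_preimage_eq_of_subset (Set.image_subset_range _ _))).symm
  · rintro g ⟨f, hf, hfg⟩ hg
    obtain ⟨f', g', hf', hg', hp⟩ := exists_pathset_eq_of_eval_eq (N + 1) hφ hK hN' hfg
    have hf₁ : f' ∈ L₁ := by
      rw [h₁]
      exact ⟨f, hf, (congrArg Prod.fst hf').symm⟩
    have hg₂ : g' ∈ L₂ := by
      rw [h₂]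
      exact ⟨g, hg, (congrArg Prod.snd hg').symm⟩
    exact Set.eq_empty_iff_forall_notMem.1 hπ _ ⟨⟨f', hf₁, rfl⟩, ⟨g', hg₂, hp.symm⟩⟩
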